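/- Let $n\ge 1$. A signed permutation of $[n]=\{1,\dots,n\}$ is a bijection $\sigma$ of $\{-n,\dots,-1,1,\dots,n\}$ onto itself with $\sigma(-i)=-\sigma(i)$ for all $i$; write $\sigma_i=\sigma(i)$ for $i\in[n]$. Let $B_n$ be the set of all signed permutations of $[n]$, and let $\mathsf{neg}(\sigma)=\#\{i\in[n]:\sigma_i<0\}$. Let $D_n\subset B_n$ be the subset of those $\sigma$ with $\mathsf{neg}(\sigma)$ even. Put $\mathsf{wex}(\sigma)=\#\{i\in[n]:\sigma_i\ge i\}$ and $\mathsf{fwex}(\sigma)=2\,\mathsf{wex}(\sigma)+\mathsf{neg}(\sigma)$. Let the Euler numbers $E_n$ be defined by $\sum_{n\ge 0}E_n\frac{x^n}{n!}=\tan x+\sec x$. Then (i) $\displaystyle\sum_{\sigma\in B_n}(-1)^{\lfloor \mathsf{fwex}(\sigma)/2\rfloor}=\begin{cases}(-1)^{n/2}\,2^n E_n & \text{if } n \text{ is even},\\ 0 & \text{if } n\text{ is odd};\end{cases}$ (ii) $\displaystyle\sum_{\sigma\in D_n}(-1)^{\lfloor \mathsf{fwex}(\sigma)/2\rfloor}=(-1)^{\lfloor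 (n+1)/2\rfloor}\,2^{n-1}E_n.$ -/

import Mathlib

/-- The set `[±n] = {-n, …, -1, 1, …, n}`. -/
abbrev PMInterval (n : ℕ) : Type :=
  {k : ℤ // k ∈ (Finset.Icc (-(n : ℤ)) (n : ℤ)).erase 0}

/-- The involution `i ↦ -i` of `[±n]`. -/
instance PMInterval.instNeg (n : ℕ) : Neg (PMInterval n) where
  neg i := ⟨-i.1, by
    have h := i.2
    simp only [Finset.mem_erase, Finset.mem_Icc] at h ⊢
    omega⟩

/-- `B_n`: the signed permutations of `[n]`, that is, the bijections `σ` of `[±n]` onto itself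
with `σ(-i) = -σ(i)` for all `i`. -/
noncomputable def signedPerms (n : ℕ) : Finset (Equiv.Perm (PMInterval n)) :=
  {σ | ∀ i, σ (-i) = -σ i}

/-- The number of negative entries among `σ_1, …, σ_n`. -/
noncomputable def negCount {n : ℕ} (σ : Equiv.Perm (PMInterval n)) : ℕ :=
  Finset.card {i : PMInterval n | 0 < i.1 ∧ (σ i).1 < 0}

/-- The number of weak excedances: `#{i ∈ [n] : σ_i ≥ i}`. -/
noncomputable def wex {n : ℕ} (σ : Equiv.Perm (PMInterval n)) : ℕ :=
  Finset.card {i : PMInterval n | 0 < i.1 ∧ i.1 ≤ (σ i).1}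

/-- The number of flag weak excedances. -/
noncomputable def fwex {n : ℕ} (σ : Equiv.Perm (PMInterval n)) : ℕ :=
  2 * wex σ + negCount σ

/-- `D_n`: the even-signed permutations of `[n]`. -/
noncomputable def evenSignedPerms (n : ℕ) : Finset (Equiv.Perm (PMInterval n)) :=
  {σ ∈ signedPerms n | Even (negCount σ)}

/-- The formal power series `tan x + sec x = sin x / cos x + 1 / cos x` over `ℚ`
(the constant term of `cos` is `1`, so `cos⁻¹` is a true inverse). -/
noncomputable def tanAddSec : PowerSeries ℚ :=
  PowerSeries.sin ℚ * (PowerSeries.cos ℚ)⁻¹ + (PowerSeries.cos ℚ)⁻¹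

/-- The Euler number `E_n`, defined by `∑ E_n x^n / n! = tan x + sec x`. -/
noncomputable def eulerNum (n : ℕ) : ℚ :=
  (n.factorial : ℚ) * PowerSeries.coeff n tanAddSec

/-! Since `fwex σ / 2 = wex σ + negCount σ / 2` and `(-1)^⌊k/2⌋` is the real plus the imaginary part
of `I ^ k`, both sums are read off from `∑ (-1) ^ wex σ * I ^ negCount σ`: real plus imaginary part
over `B_n`, real part alone over `D_n`. For a fixed underlying permutation the signs are chosen
independently, so this sum is `eulerianSum n (I - 1) (I + 1)` (`sum_weight_signedPerms`). If `D a =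
D b = a * b` and `D c = a * c`, then `D^[n] c = c * eulerianSum n a b`. Here `a = F - 1` and `b = c
= F + 1`, where `F = I * y(2 * I * x)`, `y = tan + sec`, satisfies `F' = F ^ 2 - 1`. Constant terms
give the value in `eulerianSum_I`. -/

/-! ### The differential equation of tan + sec -/

open PowerSeries in
theorem derivative_sin_rat : d⁄dX ℚ (PowerSeries.sin ℚ) = PowerSeries.cos ℚ := by
  ext n
  have h : ((n : ℚ) + 1) ≠ 0 := by positivity
  have h2 : (n.factorial : ℚ) ≠ 0 := by positivity
  rw [coeff_derivative]
  simp only [PowerSeries.sin, PowerSeries.cos, coeff_mk, Nat.even_add_one, Nat.factorial_succ]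
  split_ifs with hn
  · have : (n + 1) / 2 = n / 2 := by grind
    simp [this]
    field_simp
  · simp

open PowerSeries in
theorem derivative_cos_rat : d⁄dX ℚ (PowerSeries.cos ℚ) = -PowerSeries.sin ℚ := by
  ext n
  have h : ((n : ℚ) + 1) ≠ 0 := by positivity
  have h2 : (n.factorial : ℚ) ≠ 0 := by positivity
  rw [coeff_derivative, map_neg]
  simp only [PowerSeries.sin, PowerSeries.cos, coeff_mk, Nat.even_add_one, Nat.factorial_succ]
  split_ifs with hn
  · simp
  · have : (n + 1) / 2 = n / 2 + 1 := by grind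
    simp [this, pow_succ]
    field_simp

theorem constantCoeff_cos_rat : PowerSeries.constantCoeff (PowerSeries.cos ℚ) = 1 := by
  rw [← PowerSeries.coeff_zero_eq_constantCoeff_apply]
  simp [PowerSeries.cos]

theorem constantCoeff_sin_rat : PowerSeries.constantCoeff (PowerSeries.sin ℚ) = 0 := by
  rw [← PowerSeries.coeff_zero_eq_constantCoeff_apply]
  simp [PowerSeries.sin]

open PowerSeries in
theorem sin_sq_add_cos_sq_rat :
    PowerSeries.sin ℚ ^ 2 + PowerSeries.cos ℚ ^ 2 = 1 := by
  apply derivative.ext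
  · simp only [map_add, Derivation.leibniz_pow, derivative_sin_rat, derivative_cos_rat,
      derivative_one, smul_eq_mul, nsmul_eq_mul]
    ring
  · simp [constantCoeff_cos_rat, constantCoeff_sin_rat]

open PowerSeries in
theorem two_mul_derivative_tanAddSec : 2 * d⁄dX ℚ tanAddSec = tanAddSec ^ 2 + 1 := by
  have h1 : PowerSeries.cos ℚ * (PowerSeries.cos ℚ)⁻¹ = 1 :=
    PowerSeries.mul_inv_cancel _ (by simp [constantCoeff_cos_rat])
  have h2 := sin_sq_add_cos_sq_rat
  simp only [tanAddSec, map_add, Derivation.leibniz, derivative_inv', derivative_sin_rat,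
    derivative_cos_rat, smul_eq_mul]
  generalize PowerSeries.sin ℚ = s at *
  generalize (PowerSeries.cos ℚ)⁻¹ = i at *
  generalize PowerSeries.cos ℚ = c at *
  linear_combination (2 - (c * i + 1)) * h1 + i ^ 2 * h2

theorem constantCoeff_tanAddSec : PowerSeries.constantCoeff tanAddSec = 1 := by
  simp [tanAddSec, constantCoeff_cos_rat, constantCoeff_sin_rat]

/-- The series `I * y (2 * I * x)` with `y = tan + sec`. -/
noncomputable def rotatedTanAddSec : PowerSeries ℂ :=
  PowerSeries.C Complex.I *
    PowerSeries.rescale (2 * Complex.I) (PowerSeries.map (algebraMap ℚ ℂ) tanAddSec)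

theorem coeff_rotatedTanAddSec (n : ℕ) : PowerSeries.coeff n rotatedTanAddSec =
    Complex.I * ((2 * Complex.I) ^ n * (PowerSeries.coeff n tanAddSec : ℚ)) := by
  simp [rotatedTanAddSec, PowerSeries.coeff_rescale]

open PowerSeries in
theorem derivative_rescale_eq {R : Type*} [CommRing R] (a : R) (f : PowerSeries R) :
    d⁄dX R (rescale a f) = C a * rescale a (d⁄dX R f) := by
  ext n
  simp only [coeff_derivative, coeff_rescale, coeff_C_mul]
  ring

open PowerSeries in
theorem derivative_map_eq {R S : Type*} [CommRing R] [CommRing S] (φ : R →+* S)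
    (f : PowerSeries R) : d⁄dX S (map φ f) = map φ (d⁄dX R f) := by
  ext n
  simp [coeff_derivative]

open PowerSeries in
theorem derivative_rotatedTanAddSec :
    d⁄dX ℂ rotatedTanAddSec = (rotatedTanAddSec - 1) * (rotatedTanAddSec + 1) := by
  have h := congrArg (fun f => rescale (2 * Complex.I) (map (algebraMap ℚ ℂ) f))
    two_mul_derivative_tanAddSec
  simp only [map_mul, map_add, map_pow, map_one, map_ofNat] at h
  have hI : (C Complex.I : PowerSeries ℂ) ^ 2 = -1 := by
    rw [← map_pow, Complex.I_sq]; simp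
  simp only [rotatedTanAddSec, Derivation.leibniz, derivative_C, smul_eq_mul,
    derivative_rescale_eq, derivative_map_eq, map_mul, map_ofNat]
  generalize rescale (2 * Complex.I) (map (algebraMap ℚ ℂ) (d⁄dX ℚ tanAddSec)) = y' at *
  generalize rescale (2 * Complex.I) (map (algebraMap ℚ ℂ) tanAddSec) = y at *
  linear_combination (2 * y' - y ^ 2) * hI - h

/-! ### Eulerian polynomials from a derivation -/

theorem Derivation.leibniz_finset_prod {R A ι : Type*} [CommRing R] [CommRing A] [Algebra R A]
    [DecidableEq ι] (D : Derivation R A A) (s : Finset ι) (f : ι → A) :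
    D (∏ i ∈ s, f i) = ∑ i ∈ s, D (f i) * ∏ j ∈ s.erase i, f j := by
  induction s using Finset.induction_on with
  | empty => simp
  | insert a s ha ih =>
    rw [Finset.prod_insert ha, D.leibniz, Finset.sum_insert ha, ih, Finset.erase_insert ha,
      smul_eq_mul, smul_eq_mul, Finset.mul_sum, add_comm, mul_comm (∏ i ∈ s, f i)]
    congr 1
    refine Finset.sum_congr rfl fun i hi => ?_
    have hne : a ≠ i := fun h => ha (h ▸ hi)
    rw [Finset.erase_insert_of_ne hne, Finset.prod_insert (by simp [ha])]
    ring

/-- The homogeneous Eulerian polynomial `∑ a ^ wex π * b ^ (n - wex π)` over permutations of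
`Fin n`. -/
def eulerianSum {R : Type*} [CommRing R] (n : ℕ) (a b : R) : R :=
  ∑ π : Equiv.Perm (Fin n), ∏ i, if i ≤ π i then a else b

theorem prod_decomposeFin_symm_zero {R : Type*} [CommRing R] {n : ℕ} (a b : R)
    (π : Equiv.Perm (Fin n)) :
    (∏ i, if i ≤ Equiv.Perm.decomposeFin.symm (0, π) i then a else b) =
      a * ∏ i, if i ≤ π i then a else b := by
  rw [Fin.prod_univ_succ]
  simp

/-- Here `0 ↦ (π k).succ` contributes `a`, `k.succ ↦ 0` contributes `b`, and every other comparison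
is only shifted. So the factor at `k` becomes `a * b`, just as under the derivation. -/
theorem prod_decomposeFin_symm_succ {R : Type*} [CommRing R] {n : ℕ} (a b : R)
    (π : Equiv.Perm (Fin n)) (k : Fin n) :
    (∏ i, if i ≤ Equiv.Perm.decomposeFin.symm ((π k).succ, π) i then a else b) =
      a * b * ∏ i ∈ Finset.univ.erase k, if i ≤ π i then a else b := by
  rw [Fin.prod_univ_succ, ← Finset.mul_prod_erase Finset.univ _ (Finset.mem_univ k), ← mul_assoc]
  congr 1
  · simp
  · refine Finset.prod_congr rfl fun i hi => ?_
    have hne : π i ≠ π k := fun h => (Finset.mem_erase.1 hi).1 (π.injective h)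
    rw [Equiv.Perm.decomposeFin_symm_apply_succ, Equiv.swap_apply_of_ne_of_ne
      (Fin.succ_ne_zero _) (fun h => hne (Fin.succ_injective _ h))]
    simp

theorem eulerianSum_succ {R : Type*} [CommRing R] (n : ℕ) (a b : R) :
    eulerianSum (n + 1) a b = a * eulerianSum n a b +
      ∑ π : Equiv.Perm (Fin n), ∑ k, a * b * ∏ i ∈ Finset.univ.erase k,
        if i ≤ π i then a else b := by
  rw [eulerianSum, ← Equiv.sum_comp Equiv.Perm.decomposeFin.symm, Fintype.sum_prod_type_right,
    eulerianSum, Finset.mul_sum, ← Finset.sum_add_distrib]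
  refine Finset.sum_congr rfl fun π _ => ?_
  rw [Fin.sum_univ_succ, prod_decomposeFin_symm_zero, ← Equiv.sum_comp π]
  simp only [prod_decomposeFin_symm_succ]

theorem derivation_eulerianSum {R A : Type*} [CommRing R] [CommRing A] [Algebra R A]
    (D : Derivation R A A) {a b : A} (ha : D a = a * b) (hb : D b = a * b) (n : ℕ) :
    D (eulerianSum n a b) = ∑ π : Equiv.Perm (Fin n), ∑ k, a * b *
      ∏ i ∈ Finset.univ.erase k, if i ≤ π i then a else b := by
  simp only [eulerianSum, map_sum, D.leibniz_finset_prod]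
  refine Finset.sum_congr rfl fun π _ => Finset.sum_congr rfl fun k _ => ?_
  split_ifs <;> simp [ha, hb]

theorem iterate_derivation_eq_mul_eulerianSum {R A : Type*} [CommRing R] [CommRing A]
    [Algebra R A] (D : Derivation R A A) {a b c : A} (ha : D a = a * b) (hb : D b = a * b)
    (hc : D c = a * c) (n : ℕ) : D^[n] c = c * eulerianSum n a b := by
  induction n with
  | zero => simp [eulerianSum]
  | succ n ih =>
    rw [Function.iterate_succ_apply', ih, D.leibniz, derivation_eulerianSum D ha hb,
      eulerianSum_succ, hc, smul_eq_mul, smul_eq_mul]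
    ring

theorem map_eulerianSum {R S : Type*} [CommRing R] [CommRing S] (φ : R →+* S) (n : ℕ) (a b : R) :
    φ (eulerianSum n a b) = eulerianSum n (φ a) (φ b) := by
  simp only [eulerianSum, map_sum, map_prod, apply_ite φ]

theorem eulerianSum_I {n : ℕ} (hn : 1 ≤ n) :
    (1 + Complex.I) * eulerianSum n (Complex.I - 1) (Complex.I + 1) =
      Complex.I * ((2 * Complex.I) ^ n * (eulerNum n : ℂ)) := by
  have hd : PowerSeries.derivative ℂ (rotatedTanAddSec - 1) =
      (rotatedTanAddSec - 1) * (rotatedTanAddSec + 1) := by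
    rw [map_sub, derivative_rotatedTanAddSec, PowerSeries.derivative_one, sub_zero]
  have hd' : PowerSeries.derivative ℂ (rotatedTanAddSec + 1) =
      (rotatedTanAddSec - 1) * (rotatedTanAddSec + 1) := by
    rw [map_add, derivative_rotatedTanAddSec, PowerSeries.derivative_one, add_zero]
  -- `F` has constant term `I`, so `a` and `b` evaluate to `I - 1` and `I + 1`.
  have h := congrArg PowerSeries.constantCoeff
    (iterate_derivation_eq_mul_eulerianSum _ hd hd' hd' n)
  have h0 : PowerSeries.constantCoeff rotatedTanAddSec = Complex.I := by
    rw [← PowerSeries.coeff_zero_eq_constantCoeff_apply, coeff_rotatedTanAddSec,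
      PowerSeries.coeff_zero_eq_constantCoeff_apply, constantCoeff_tanAddSec]
    simp
  rw [PowerSeries.constantCoeff_iterate_derivative, map_mul, map_eulerianSum, map_sub,
    map_add PowerSeries.constantCoeff, map_one PowerSeries.constantCoeff, h0, map_add, coeff_rotatedTanAddSec, PowerSeries.coeff_one, if_neg (by omega)] at h
  rw [add_comm 1, ← h, eulerNum]
  simp
  ring

/-! ### Signed permutations as pairs of a permutation and signs -/

/-- The identification of `[±n]` with pairs of an absolute value and a sign, `true` being
negative. -/
def signedEquiv (n : ℕ) : Fin n × Bool ≃ PMInterval n where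
  toFun p := ⟨if p.2 then -((p.1 : ℤ) + 1) else (p.1 : ℤ) + 1, by
    have := p.1.2
    simp only [Finset.mem_erase, Finset.mem_Icc]
    split_ifs <;> omega⟩
  invFun k := (⟨k.1.natAbs - 1, by
    have := k.2
    simp only [Finset.mem_erase, Finset.mem_Icc] at this
    omega⟩, decide (k.1 < 0))
  left_inv p := by
    rcases p with ⟨i, _ | _⟩
    · ext <;> simp <;> omega
    · ext <;> simp <;> omega
  right_inv k := by
    have := k.2
    simp only [Finset.mem_erase, Finset.mem_Icc] at this
    ext
    by_cases h : k.1 < 0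
    · simp [h]; omega
    · simp [h]; omega

theorem neg_signedEquiv {n : ℕ} (i : Fin n) (b : Bool) :
    -signedEquiv n (i, b) = signedEquiv n (i, !b) := by
  apply Subtype.ext
  change -(signedEquiv n (i, b)).1 = _
  cases b <;> simp [signedEquiv]

theorem signedEquiv_pos {n : ℕ} (i : Fin n) (b : Bool) :
    0 < (signedEquiv n (i, b)).1 ↔ b = false := by
  cases b <;> simp [signedEquiv]

theorem signedEquiv_neg {n : ℕ} (i : Fin n) (b : Bool) :
    (signedEquiv n (i, b)).1 < 0 ↔ b = true := by
  cases b <;> simp [signedEquiv] <;> omega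

theorem signedEquiv_false_le {n : ℕ} (i j : Fin n) (b : Bool) :
    signedEquiv n (i, false) ≤ signedEquiv n (j, b) ↔ b = false ∧ i ≤ j := by
  rw [← Subtype.coe_le_coe]
  cases b
  · simp only [signedEquiv, Equiv.coe_fn_mk, Fin.le_def]
    simp
  · simp only [signedEquiv, Equiv.coe_fn_mk, Fin.le_def]
    simp only [Bool.false_eq_true, if_false, if_true, reduceCtorEq, false_and, iff_false]
    omega

/-- The signed permutation with underlying permutation `π` and negative entries where `s` is
`true`. -/
def signedPermOf {n : ℕ} (p : Equiv.Perm (Fin n) × (Fin n → Bool)) :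
    Equiv.Perm (PMInterval n) :=
  (signedEquiv n).permCongr
    (Equiv.prodShear p.1 fun i => if p.2 i then Equiv.boolNot else Equiv.refl Bool)

theorem signedPermOf_apply {n : ℕ} (p : Equiv.Perm (Fin n) × (Fin n → Bool)) (i : Fin n)
    (b : Bool) : signedPermOf p (signedEquiv n (i, b)) = signedEquiv n (p.1 i, p.2 i ^^ b) := by
  simp only [signedPermOf, Equiv.permCongr_apply, Equiv.symm_apply_apply]
  cases h : p.2 i <;> simp [Equiv.prodShear, h]

theorem signedPermOf_mem {n : ℕ} (p : Equiv.Perm (Fin n) × (Fin n → Bool)) :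
    signedPermOf p ∈ signedPerms n := by
  simp only [signedPerms, Finset.mem_filter, Finset.mem_univ, true_and]
  intro k
  obtain ⟨⟨i, b⟩, rfl⟩ := (signedEquiv n).surjective k
  rw [neg_signedEquiv, signedPermOf_apply, signedPermOf_apply, neg_signedEquiv]
  simp

theorem signedPermOf_injective {n : ℕ} :
    Function.Injective (signedPermOf : _ → Equiv.Perm (PMInterval n)) := by
  intro p q h
  have key : ∀ i, p.1 i = q.1 i ∧ p.2 i = q.2 i := by
    intro i
    have := congrArg (fun σ => σ (signedEquiv n (i, false))) h
    simpa [signedPermOf_apply] using this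
  exact Prod.ext (Equiv.ext fun i => (key i).1) (funext fun i => (key i).2)

theorem exists_signedPermOf_eq {n : ℕ} {σ : Equiv.Perm (PMInterval n)} (hσ : σ ∈ signedPerms n) :
    ∃ p, signedPermOf p = σ := by
  simp only [signedPerms, Finset.mem_filter, Finset.mem_univ, true_and] at hσ
  let g : Fin n → Fin n × Bool := fun i => (signedEquiv n).symm (σ (signedEquiv n (i, false)))
  have hg : ∀ i, σ (signedEquiv n (i, false)) = signedEquiv n ((g i).1, (g i).2) := by
    intro i; simp [g]
  have hg' : ∀ i, σ (signedEquiv n (i, true)) = signedEquiv n ((g i).1, !(g i).2) := by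
    intro i
    rw [← neg_signedEquiv, ← hg, ← hσ, neg_signedEquiv, Bool.not_false]
  have hinj : Function.Injective fun i => (g i).1 := by
    intro i j hij
    have hij : (g i).1 = (g j).1 := hij
    by_cases hb : (g i).2 = (g j).2
    · have h : σ (signedEquiv n (i, false)) = σ (signedEquiv n (j, false)) := by
        rw [hg, hg, hij, hb]
      simpa using h
    -- Opposite signs would make `σ` agree at a positive and a negative point.
    · have h : σ (signedEquiv n (i, false)) = σ (signedEquiv n (j, true)) := by
        rw [hg, hg', hij, Bool.eq_not.2 hb]
      simp at h
  refine ⟨(Equiv.ofBijective _ (Finite.injective_iff_bijective.1 hinj), fun i => (g i).2), ?_⟩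
  ext1 k
  obtain ⟨⟨i, b⟩, rfl⟩ := (signedEquiv n).surjective k
  rw [signedPermOf_apply]
  cases b
  · simp [hg]
  · simp [hg']

theorem sum_signedPerms {M : Type*} [AddCommMonoid M] {n : ℕ}
    (f : Equiv.Perm (PMInterval n) → M) :
    ∑ σ ∈ signedPerms n, f σ = ∑ p, f (signedPermOf p) :=
  (Finset.sum_bij (fun p _ => signedPermOf p) (fun p _ => signedPermOf_mem p)
    (fun _ _ _ _ h => signedPermOf_injective h)
    (fun _ hσ => (exists_signedPermOf_eq hσ).imp fun _ h => ⟨Finset.mem_univ _, h⟩)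
    (fun _ _ => rfl)).symm

/-! ### Complex weights and their sums -/

theorem weight_signedPermOf {n : ℕ} (p : Equiv.Perm (Fin n) × (Fin n → Bool)) :
    (-1 : ℂ) ^ wex (signedPermOf p) * Complex.I ^ negCount (signedPermOf p) =
      ∏ i, if p.2 i then Complex.I else if i ≤ p.1 i then -1 else 1 := by
  rw [wex, negCount, ← Finset.prod_const, ← Finset.prod_const, Finset.prod_filter,
    Finset.prod_filter, ← Finset.prod_mul_distrib, ← Equiv.prod_comp (signedEquiv n),
    Fintype.prod_prod_type]
  refine Finset.prod_congr rfl fun i _ => ?_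
  simp only [Fintype.prod_bool, signedPermOf_apply, signedEquiv_pos, signedEquiv_neg]
  cases h : p.2 i <;> simp [signedEquiv_false_le]

theorem sum_weight_signedPerms (n : ℕ) :
    ∑ σ ∈ signedPerms n, (-1 : ℂ) ^ wex σ * Complex.I ^ negCount σ =
      eulerianSum n (Complex.I - 1) (Complex.I + 1) := by
  rw [sum_signedPerms, Fintype.sum_prod_type, eulerianSum]
  refine Finset.sum_congr rfl fun π _ => ?_
  simp only [weight_signedPermOf]
  have h := Finset.prod_univ_sum (fun _ : Fin n => (Finset.univ : Finset Bool))
    fun i b => if b then Complex.I else if i ≤ π i then (-1 : ℂ) else 1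
  rw [Fintype.piFinset_univ] at h
  rw [← h]
  refine Finset.prod_congr rfl fun i _ => ?_
  rw [Fintype.sum_bool]
  split_ifs <;> simp_all
  ring

theorem sign_fwex_eq_re_add_im {n : ℕ} (σ : Equiv.Perm (PMInterval n)) :
    (((-1 : ℚ) ^ (fwex σ / 2) : ℚ) : ℝ) =
      ((-1 : ℂ) ^ wex σ * Complex.I ^ negCount σ).re +
        ((-1 : ℂ) ^ wex σ * Complex.I ^ negCount σ).im := by
  have h1 : fwex σ / 2 = wex σ + negCount σ / 2 := by rw [fwex]; omega
  have h2 : (-1 : ℂ) ^ wex σ = (((-1 : ℝ) ^ wex σ : ℝ) : ℂ) := by push_cast; rfl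
  have h3 : (-1 : ℂ) ^ (negCount σ / 2) = (((-1 : ℝ) ^ (negCount σ / 2) : ℝ) : ℂ) := by
    push_cast; rfl
  have h4 : Complex.I ^ negCount σ =
      (((-1 : ℝ) ^ (negCount σ / 2) : ℝ) : ℂ) * Complex.I ^ (negCount σ % 2) := by
    rw [← h3, ← Complex.I_sq, ← pow_mul, ← pow_add, Nat.div_add_mod]
  rw [h1, h2, h4, pow_add, Complex.re_ofReal_mul, Complex.im_ofReal_mul, Complex.re_ofReal_mul,
    Complex.im_ofReal_mul]
  rcases Nat.mod_two_eq_zero_or_one (negCount σ) with h | h <;> simp [h]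

theorem re_weight_eq {n : ℕ} (σ : Equiv.Perm (PMInterval n)) :
    ((-1 : ℂ) ^ wex σ * Complex.I ^ negCount σ).re =
      if Even (negCount σ) then (((-1 : ℚ) ^ (fwex σ / 2) : ℚ) : ℝ) else 0 := by
  have h2 : (-1 : ℂ) ^ wex σ = (((-1 : ℝ) ^ wex σ : ℝ) : ℂ) := by push_cast; rfl
  have h3 (m : ℕ) : Complex.I ^ (2 * m) = (((-1 : ℝ) ^ m : ℝ) : ℂ) := by
    rw [pow_mul, Complex.I_sq]; push_cast; rfl
  split_ifs with h
  · obtain ⟨m, hm⟩ := even_iff_two_dvd.1 h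
    rw [sign_fwex_eq_re_add_im, hm, h2, h3, Complex.im_ofReal_mul, Complex.ofReal_im, mul_zero,
      add_zero]
  · obtain ⟨m, hm⟩ := Nat.not_even_iff_odd.1 h
    rw [hm, pow_succ, h2, h3, Complex.re_ofReal_mul, Complex.re_ofReal_mul, Complex.I_re]
    simp

theorem sum_signedPerms_eq (n : ℕ) :
    ((∑ σ ∈ signedPerms n, (-1 : ℚ) ^ (fwex σ / 2) : ℚ) : ℝ) =
      (eulerianSum n (Complex.I - 1) (Complex.I + 1)).re +
        (eulerianSum n (Complex.I - 1) (Complex.I + 1)).im := by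
  rw [← sum_weight_signedPerms, Complex.re_sum, Complex.im_sum, ← Finset.sum_add_distrib,
    Rat.cast_sum]
  exact Finset.sum_congr rfl fun σ _ => sign_fwex_eq_re_add_im σ

theorem sum_evenSignedPerms_eq (n : ℕ) :
    ((∑ σ ∈ evenSignedPerms n, (-1 : ℚ) ^ (fwex σ / 2) : ℚ) : ℝ) =
      (eulerianSum n (Complex.I - 1) (Complex.I + 1)).re := by
  rw [← sum_weight_signedPerms, Complex.re_sum, Rat.cast_sum, evenSignedPerms, Finset.sum_filter]
  exact Finset.sum_congr rfl fun σ _ => (re_weight_eq σ).symm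

/-- Division by `1 + I` uses `(1 + I) ^ 2 = 2 * I`. -/
theorem eulerianSum_I_eq {n : ℕ} (hn : 1 ≤ n) :
    eulerianSum n (Complex.I - 1) (Complex.I + 1) =
      Complex.I ^ n * (1 + Complex.I) * ((2 ^ (n - 1) * eulerNum n : ℝ) : ℂ) := by
  have h0 : (1 + Complex.I) ≠ 0 := fun h => by simpa using congrArg Complex.re h
  apply mul_left_cancel₀ h0
  rw [eulerianSum_I hn]
  obtain ⟨m, rfl⟩ := Nat.exists_eq_add_of_le' hn
  push_cast
  rw [mul_pow, pow_succ 2]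
  linear_combination (-(Complex.I ^ (m + 1) * 2 ^ m * eulerNum (m + 1))) * Complex.I_sq

theorem corollary1p5 (n : ℕ) (hn : 1 ≤ n) :
    ((Even n → ∑ σ ∈ signedPerms n, (-1 : ℚ) ^ (fwex σ / 2) =
        (-1 : ℚ) ^ (n / 2) * 2 ^ n * eulerNum n) ∧
      (Odd n → ∑ σ ∈ signedPerms n, (-1 : ℚ) ^ (fwex σ / 2) = 0)) ∧
    ∑ σ ∈ evenSignedPerms n, (-1 : ℚ) ^ (fwex σ / 2) =
      (-1 : ℚ) ^ ((n + 1) / 2) * 2 ^ (n - 1) * eulerNum n := by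
  have hB := sum_signedPerms_eq n
  have hD := sum_evenSignedPerms_eq n
  rw [eulerianSum_I_eq hn, Complex.re_mul_ofReal] at hD
  rw [eulerianSum_I_eq hn, Complex.re_mul_ofReal, Complex.im_mul_ofReal] at hB
  have hI (m : ℕ) : Complex.I ^ (2 * m) = (((-1 : ℝ) ^ m : ℝ) : ℂ) := by
    rw [pow_mul, Complex.I_sq]; push_cast; rfl
  rcases Nat.even_or_odd' n with ⟨m, hm | hm⟩
  · have hp : (2 : ℝ) ^ n = 2 * 2 ^ (n - 1) := by
      rw [← pow_succ', Nat.sub_add_cancel hn]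
    have hI' : Complex.I ^ n = (((-1 : ℝ) ^ m : ℝ) : ℂ) := by rw [hm, hI]
    rw [hI', Complex.re_ofReal_mul] at hB hD
    rw [Complex.im_ofReal_mul] at hB
    simp only [Complex.add_re, Complex.one_re, Complex.I_re, Complex.add_im, Complex.one_im,
      Complex.I_im] at hB hD
    refine ⟨⟨fun _ => ?_, fun h => absurd h (by grind)⟩, ?_⟩
    · apply Rat.cast_injective (α := ℝ)
      rw [hB, show n / 2 = m by omega]
      push_cast
      rw [hp]
      ring
    · apply Rat.cast_injective (α := ℝ)
      rw [hD, show (n + 1) / 2 = m by omega]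
      push_cast
      ring
  -- For odd `n`, the real and imaginary parts of `I - 1` cancel over `B_n`; over `D_n` the real
  -- part `-1` raises the exponent to `m + 1`.
  · have hI' : Complex.I ^ n * (1 + Complex.I) =
        (((-1 : ℝ) ^ m : ℝ) : ℂ) * (Complex.I - 1) := by
      rw [hm, pow_succ, hI]
      linear_combination (((-1 : ℝ) ^ m : ℝ) : ℂ) * Complex.I_sq
    rw [hI', Complex.re_ofReal_mul] at hB hD
    rw [Complex.im_ofReal_mul] at hB
    simp only [Complex.sub_re, Complex.one_re, Complex.I_re, Complex.sub_im, Complex.one_im,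
      Complex.I_im] at hB hD
    refine ⟨⟨fun h => absurd h (by grind), fun _ => ?_⟩, ?_⟩
    · apply Rat.cast_injective (α := ℝ)
      rw [hB]
      push_cast
      ring
    · apply Rat.cast_injective (α := ℝ)
      rw [hD, show (n + 1) / 2 = m + 1 by omega]
      push_cast
      ring
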